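/- Let $p$ be a prime, $n\ge 1$, and let $K/F$ be a Galois extension of fields whose group is cyclic of order $p^n$. For $0\le j\le n$ let $K_j$ be the intermediate field with $[K_j:F]=p^j$. Suppose that $F$ contains a primitive $p$-th root of unity $\xi_p$ and, if $p=2$, that $n>1$ or $-1\in N_{K/F}(K^\times)$. For a cyclic extension $L/E$ of degree $p^r$ ($r\ge 1$) write $[\gamma]$ for the class of $\gamma\in L^\times$ in $L^\times/L^{\times p}$ and $[f]_E$ for the class of $f\in E^\times$ in $E^\times/E^{\times p}$; for $0\le i\le r$ let $L_i$ be the intermediate field with $[L_i:E]=p^i$, let $L_{-\infty}^\times=\{1\}$, and let $[L_i^\times]$ be the image of $L_i^\times$ in $L^\times/L^{\times p}$. Put $$i(L/E)=\min\{\,i\in\{-\infty,0,1,\dots,r\} : \exists\,\delta\in L^\times,\ [N_{L/E}(\delta)]_E\ne[1]_E \text{ and } [\delta]^{\tau-1}\in[L_i^\times]\ \forall \tau\in \mathrm{Gal}(L/E)\,\}$$ whenever this set is non-empty. Then $i(K/F)$ is defined, and the following invariants are defined and have the stated values. 1. For each $0\le j\le n-1$: $$i(K/K_j)=\begin{cases}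 i(K/F)-j, & 0\le j\le i(K/F),\\ -\infty, & 0\le i(K/F)<j,\\ -\infty, & i(K/F)=-\infty.\end{cases}$$ 2. For each $0<j\le n-1$: $i(K_j/F)=-\infty$. -/

import Mathlib

/-- The group `J(K) = Kˣ / (Kˣ)ᵖ` of `p`-th power classes of a field `K`. -/
abbrev PowerClasses (p : ℕ) (K : Type*) [Field K] : Type _ :=
  Kˣ ⧸ (powMonoidHom p : Kˣ →* Kˣ).range

/-- The class `[γ]` of `γ ∈ Kˣ` in `J(K)`. -/
def powerClass (p : ℕ) {K : Type*} [Field K] (γ : Kˣ) : PowerClasses p K :=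
  QuotientGroup.mk γ

/-- The subset `[K_iˣ]` of `J(K)`, where `K_i` is the intermediate field of degree `p ^ i` over
`F` (it is unique when `K/F` is cyclic of degree `p ^ n` and `i ≤ n`; for `i > n` there is none
and the set is empty), and where by convention `K_{-∞}ˣ = {1}`; here `⊥` is `-∞`. -/
def levelClasses (p : ℕ) (F K : Type*) [Field F] [Field K] [Algebra F K] :
    WithBot ℕ → Set (PowerClasses p K)
  | none => {1}
  | some i => {c | ∃ E : IntermediateField F K, Module.finrank F E = p ^ i ∧
      ∃ x : Eˣ, c = powerClass p (Units.map (algebraMap E K : E →* K) x)}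

/-- `IsLevelOf p F K i δ` : `[N_{K/F}(δ)]_F ≠ [1]_F`, and `[δ]^(τ-1) ∈ [K_iˣ]` for all
`τ ∈ Gal(K/F)`. -/
def IsLevelOf (p : ℕ) (F K : Type*) [Field F] [Field K] [Algebra F K]
    (i : WithBot ℕ) (δ : Kˣ) : Prop :=
  powerClass p (Units.map (Algebra.norm F : K →* F) δ) ≠ powerClass p (1 : Fˣ) ∧
  ∀ τ : Gal(K/F),
    powerClass p (Units.map (τ : K →* K) δ) / powerClass p δ ∈ levelClasses p F K i

/-- `IsFieldIndex p F K m` : the minimum defining the invariant `i(K/F)` exists and equals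
`m ∈ {-∞, 0, 1, …}`. For `K/F` cyclic of degree `p ^ n` only `i ≤ n` can lie in the set, as
`[K_iˣ]` is empty otherwise. -/
def IsFieldIndex (p : ℕ) (F K : Type*) [Field F] [Field K] [Algebra F K]
    (m : WithBot ℕ) : Prop :=
  IsLeast {i : WithBot ℕ | ∃ δ : Kˣ, IsLevelOf p F K i δ} m

/-! Let σ generate the Galois group and put ξ = ξ_p. Everything reduces to norms of ξ: i(K/F) + 1 is
the least s such that ξ is a norm from K to K_s, with s = 0 standing for -∞. Such s form an up-set
containing n. Taking K_j as base only shifts the indices by j, which gives part 1. Part 2 holds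
because, for j < n, there is α ∈ K_{j+1} with σ^{p^j} α = ξα; then σα/α lies in K_j and its norm to
F telescopes to ξ.

For the criterion, let σδ/δ = x k^p with x ∈ K_i, i < n. Then N_{K/F}(δ) = E^p for an explicit E,
and σE/E = N_{K_i/F}(x)^{p^{n-i-1}} N_{K/F}(k). This is a p-th root of unity, trivial exactly when
N_{K/F}(δ) is a p-th power in F (`isNormPow_iff_of_smul_div_eq`). So level i occurs iff ξ has this
form for some x, k, and Hilbert 90 turns that into ξ being a norm from K to K_{i+1}
(`exists_level_iff`). Only degree p^n = 2 escapes the computation; it arises over K_{n-1} and is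
treated by hand. -/

theorem pow_smul_eq_self {G α : Type*} [Group G] [MulAction G α] {g : G} {x : α} (h : g • x = x)
    (j : ℕ) : g ^ j • x = x :=
  (MulAction.stabilizer G x).pow_mem h j

open Finset in
/-- The partial norm `x * g x * ⋯ * g ^ (q - 1) x`. -/
def partialNorm {G M : Type*} [Group G] [CommGroup M] [MulDistribMulAction G M] (g : G) (q : ℕ) :
    M →* M where
  toFun x := ∏ j ∈ range q, g ^ j • x
  map_one' := by simp
  map_mul' x y := by simp [prod_mul_distrib]

/-! ### Telescoping identities for partial norms -/

namespace partialNorm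

open Finset

variable {G M : Type*} [Group G] [CommGroup M] [MulDistribMulAction G M]

theorem apply_eq (g : G) (q : ℕ) (x : M) : partialNorm g q x = ∏ j ∈ range q, g ^ j • x := rfl

@[simp] theorem zero_apply (g : G) (x : M) : partialNorm g 0 x = 1 := by simp [apply_eq]

@[simp] theorem one_apply (g : G) (x : M) : partialNorm g 1 x = x := by simp [apply_eq]

theorem add_apply (g : G) (a b : ℕ) (x : M) :
    partialNorm g (a + b) x = partialNorm g a x * g ^ a • partialNorm g b x := by
  simp [apply_eq, prod_range_add, smul_prod', pow_add, mul_smul]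

theorem succ_apply (g : G) (a : ℕ) (x : M) :
    partialNorm g (a + 1) x = partialNorm g a x * g ^ a • x := by
  simp [add_apply]

theorem smul_of_commute {g h : G} (hc : Commute h g) (q : ℕ) (x : M) :
    h • partialNorm g q x = partialNorm g q (h • x) := by
  simp only [apply_eq, smul_prod', ← mul_smul, (hc.pow_right _).eq]

theorem smul_div (g : G) (q : ℕ) (x : M) :
    g • partialNorm g q x / partialNorm g q x = g ^ q • x / x := by
  induction q with
  | zero => simp
  | succ q ih =>
    rw [succ_apply, smul_mul', mul_div_mul_comm, ih, ← mul_smul, ← pow_succ']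
    simp

theorem apply_smul_div (g : G) (q : ℕ) (x : M) :
    partialNorm g q (g • x / x) = g ^ q • x / x := by
  rw [map_div, ← smul_of_commute (Commute.refl g), smul_div]

theorem mul_apply (g : G) (q r : ℕ) (x : M) :
    partialNorm g (q * r) x = partialNorm (g ^ q) r (partialNorm g q x) := by
  induction r with
  | zero => simp
  | succ r ih => rw [mul_add_one, add_apply, ih, succ_apply, pow_mul]

theorem mul_apply' (g : G) (q r : ℕ) (x : M) :
    partialNorm g (q * r) x = partialNorm g q (partialNorm (g ^ q) r x) := by
  rw [mul_apply]
  simp only [apply_eq (g ^ q), map_prod]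
  refine prod_congr rfl fun j _ => smul_of_commute ?_ q x
  exact ((Commute.refl g).pow_left q).pow_left j

theorem of_fixed {g : G} {x : M} (h : g • x = x) (q : ℕ) : partialNorm g q x = x ^ q := by
  induction q with
  | zero => simp
  | succ q ih =>
    rw [succ_apply, ih, pow_succ, pow_smul_eq_self h]

/-- Divide the index by q with remainder: the block of quotient t contributes a factor `partialNorm
g q x ^ t` for each of its q indices. -/
theorem prod_apply_mul {g : G} {q : ℕ} {x : M} (h : g ^ q • x = x) (r : ℕ) :
    ∏ j ∈ range (q * r), partialNorm g j x =
      (∏ j ∈ range q, partialNorm g j x) ^ r * partialNorm g q x ^ (q * ∑ t ∈ range r, t) := by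
  have hfix : ∀ j, g ^ q • partialNorm g j x = partialNorm g j x := fun j => by
    rw [smul_of_commute ((Commute.refl g).pow_left q), h]
  induction r with
  | zero => simp
  | succ r ih =>
    have hstep : ∀ j, partialNorm g (q * r + j) x = partialNorm g q x ^ r * partialNorm g j x := by
      intro j
      rw [add_apply, mul_apply, of_fixed (hfix q), pow_mul,
        pow_smul_eq_self (hfix j)]
    rw [mul_add_one, prod_range_add, ih, sum_range_succ]
    simp only [hstep, prod_mul_distrib, prod_const, card_range]
    rw [mul_add, pow_add _ (q * _), pow_succ _ r, ← pow_mul, mul_comm r q, mul_assoc, mul_assoc,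
      ← mul_assoc (_ ^ (q * _)), mul_comm (_ * _) (∏ j ∈ range q, _)]

theorem smul_div_prod {g : G} (q : ℕ) (x : M) :
    g • (∏ j ∈ range q, partialNorm g j x) / ∏ j ∈ range q, partialNorm g j x =
      partialNorm g q x / x ^ q := by
  rw [smul_prod', ← prod_div_distrib]
  simp only [smul_div, prod_div_distrib, prod_const, card_range]
  rfl

/-- Each factor g^j x equals x times the j-th partial norm of gx/x. -/
theorem apply_eq_pow_mul_prod (g : G) (q : ℕ) (x : M) :
    partialNorm g q x = x ^ q * ∏ j ∈ range q, partialNorm g j (g • x / x) := by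
  simp only [apply_smul_div, prod_div_distrib, prod_const, card_range]
  rw [mul_div_cancel]
  rfl

end partialNorm

/-! ### Norm criterion for the levels -/

/-- The properties of the multiplicative group `M` of a cyclic extension of degree `p ^ n` with
generator `s` of the Galois group, over a field with a primitive `p`-th root of unity `ξ`, which
determine the norms of the elements whose class is fixed up to a subfield. -/
structure IsCyclicKummer {G M : Type*} [Group G] [CommGroup M] [MulDistribMulAction G M]
    (p n : ℕ) (s : G) (ξ : M) : Prop where
  prime : p.Prime
  pow_eq_one : s ^ p ^ n = 1
  hilbert90 : ∀ i ≤ n, ∀ x : M, partialNorm (s ^ p ^ i) (p ^ (n - i)) x = 1 →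
    ∃ l : M, s ^ p ^ i • l / l = x
  smul_root : ∀ ζ : M, ζ ^ p = 1 → s • ζ = ζ
  exists_pow_eq : ∀ ζ : M, ζ ^ p = 1 → ζ ≠ 1 → ∃ d : ℕ, ζ ^ d = ξ
  root_pow : ξ ^ p = 1
  root_ne : ξ ≠ 1

/-- The root of unity `ξ` is a norm from the top to the `i`-th level. -/
def IsRootNorm {G M : Type*} [Group G] [CommGroup M] [MulDistribMulAction G M]
    (p n : ℕ) (s : G) (ξ : M) (i : ℕ) : Prop :=
  ∃ k : M, partialNorm (s ^ p ^ i) (p ^ (n - i)) k = ξ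

/-- The norm of `δ` to the ground level is a `p`-th power there. -/
def IsNormPow {G M : Type*} [Group G] [CommGroup M] [MulDistribMulAction G M]
    (p n : ℕ) (s : G) (δ : M) : Prop :=
  ∃ f : M, s • f = f ∧ partialNorm s (p ^ n) δ = f ^ p

namespace IsCyclicKummer

open Finset partialNorm

variable {G M : Type*} [Group G] [CommGroup M] [MulDistribMulAction G M]
  {p n : ℕ} {s : G} {ξ : M}

theorem hilbert90_zero (h : IsCyclicKummer p n s ξ) {x : M} (hx : partialNorm s (p ^ n) x = 1) :
    ∃ l : M, s • l / l = x := by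
  simpa using h.hilbert90 0 n.zero_le x (by simpa using hx)

/-- The solution over the ground level already lies in level i, since the partial norm of sl/l
telescopes to s^{p^i} l / l. -/
theorem hilbert90_fixed (h : IsCyclicKummer p n s ξ) {i : ℕ} (hi : i ≤ n) {x : M}
    (hx : partialNorm s (p ^ i) x = 1) :
    ∃ l : M, s ^ p ^ i • l = l ∧ s • l / l = x := by
  obtain ⟨l, hl⟩ := h.hilbert90_zero (x := x) (by
    rw [← Nat.add_sub_cancel' hi, pow_add, mul_apply, hx, map_one])
  refine ⟨l, ?_, hl⟩
  rw [← hl, apply_smul_div] at hx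
  exact div_eq_one.mp hx

theorem smul_root_pow (h : IsCyclicKummer p n s ξ) (j : ℕ) : s ^ j • ξ = ξ :=
  pow_smul_eq_self (h.smul_root ξ h.root_pow) j

/-- Hilbert 90 applies because ξ is fixed, so its norm is a power with exponent p^{n-i}, divisible
by p when i < n. -/
theorem exists_kummer_generator (h : IsCyclicKummer p n s ξ) {i : ℕ} (hi : i < n) :
    ∃ α : M, s ^ p ^ i • α = ξ * α ∧ s ^ p ^ (i + 1) • α = α := by
  obtain ⟨α, hα⟩ := h.hilbert90 i hi.le ξ (by
    rw [of_fixed (h.smul_root_pow _)]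
    obtain ⟨m, hm⟩ := Nat.exists_eq_add_of_lt hi
    rw [show n - i = m + 1 by omega, pow_succ', pow_mul, h.root_pow, one_pow])
  rw [div_eq_iff_eq_mul] at hα
  refine ⟨α, hα, ?_⟩
  have : ∀ t : ℕ, (s ^ p ^ i) ^ t • α = ξ ^ t * α := by
    intro t
    induction t with
    | zero => simp
    | succ t ih =>
      rw [pow_succ', mul_smul, ih, smul_mul', smul_pow', h.smul_root_pow, hα, pow_succ, mul_assoc]
  rw [pow_succ, pow_mul, this, h.root_pow, one_mul]

/-- For `i < n`, the root of unity `ξ` is a norm from the `i`-th level to the ground level. -/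
theorem exists_fixed_norm_eq_root (h : IsCyclicKummer p n s ξ) {i : ℕ} (hi : i < n) :
    ∃ b : M, s ^ p ^ i • b = b ∧ partialNorm s (p ^ i) b = ξ := by
  obtain ⟨α, hα, -⟩ := h.exists_kummer_generator hi
  refine ⟨s • α / α, ?_, ?_⟩
  · rw [smul_div', ← mul_smul, ← pow_succ, pow_succ', mul_smul, hα, smul_mul',
      h.smul_root ξ h.root_pow, mul_div_mul_left_eq_div]
  · rw [apply_smul_div, hα, mul_div_cancel_right]

/-- The norm of δ is E^p with E = δ^N W Y. As p-th roots of unity are fixed, it is the p-th power of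
a fixed element iff E itself is fixed; the right-hand side is sE/E = 1. -/
theorem isNormPow_iff (h : IsCyclicKummer p n s ξ) {δ x k W : M} {N : ℕ} (hN : p ^ n = p * N)
    (hδ : s • δ / δ = x * k ^ p) (hW : ∏ j ∈ range (p ^ n), partialNorm s j x = W ^ p) :
    IsNormPow p n s δ ↔ x ^ N * (s • W / W) * partialNorm s (p ^ n) k = 1 := by
  set Y := ∏ j ∈ range (p ^ n), partialNorm s j k with hY
  set E := δ ^ N * W * Y with hE
  have hnorm : partialNorm s (p ^ n) δ = E ^ p := by
    rw [apply_eq_pow_mul_prod, hδ]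
    simp only [map_mul, map_pow, prod_mul_distrib, hW, prod_pow]
    rw [← hY, hE, hN, mul_pow, mul_pow, ← pow_mul, mul_comm p N, mul_assoc]
  have hs : s • E / E = x ^ N * (s • W / W) * partialNorm s (p ^ n) k := by
    have h1 : s • E / E = (s • δ / δ) ^ N * (s • W / W) * (s • Y / Y) := by
      rw [hE, smul_mul', smul_mul', smul_pow', mul_div_mul_comm, mul_div_mul_comm, div_pow]
    rw [h1, hδ, hY, smul_div_prod, mul_pow, ← pow_mul, ← hN, mul_right_comm (x ^ N),
      mul_assoc (_ * _), mul_div_cancel]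
  rw [← hs, div_eq_one]
  constructor
  · rintro ⟨f, hf, hfE⟩
    rw [hnorm] at hfE
    have := h.smul_root (E / f) (by rw [div_pow, hfE, div_self'])
    rw [smul_div', hf] at this
    simpa using this
  · exact fun hE' => ⟨E, hE', hnorm⟩

theorem isNormPow_iff_of_smul_div_eq_pow (h : IsCyclicKummer p n s ξ) (hn : 1 ≤ n) {δ k : M}
    (hδ : s • δ / δ = k ^ p) : IsNormPow p n s δ ↔ partialNorm s (p ^ n) k = 1 := by
  rw [h.isNormPow_iff (x := 1) (W := 1) (k := k) (N := p ^ (n - 1))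
    (by rw [← pow_succ', Nat.sub_add_cancel hn]) (by simpa using hδ) (by simp)]
  simp

theorem isNormPow_iff_of_smul_div_eq (h : IsCyclicKummer p n s ξ) {i : ℕ} (hi : i < n)
    (h2 : p = 2 → n ≠ 1) {δ x k : M} (hx : s ^ p ^ i • x = x) (hδ : s • δ / δ = x * k ^ p) :
    IsNormPow p n s δ ↔
      partialNorm s (p ^ i) x ^ p ^ (n - i - 1) * partialNorm s (p ^ n) k = 1 := by
  obtain ⟨m, rfl⟩ := Nat.exists_eq_add_of_lt hi
  -- This is the exponent of the norm y of x in the product of all partial norms. It is prime to p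
  -- only for p = 2, i = 0, n = 1.
  obtain ⟨e, he⟩ : p ∣ p ^ i * ∑ t ∈ range (p ^ (m + 1)), t := by
    rcases h.prime.eq_two_or_odd' with rfl | hodd
    · have := sum_range_id_mul_two (2 ^ (m + 1))
      rcases Nat.eq_zero_or_pos i with rfl | hi0
      · obtain ⟨m', rfl⟩ := Nat.exists_eq_succ_of_ne_zero (n := m) (by rintro rfl; exact h2 rfl rfl)
        refine ⟨2 ^ m' * (2 ^ (m' + 2) - 1), Nat.eq_of_mul_eq_mul_right two_pos ?_⟩
        rw [mul_assoc, this]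
        simp only [Nat.succ_eq_add_one, pow_succ]
        ring
      · exact (dvd_pow_self 2 hi0.ne').mul_right _
    · refine Dvd.dvd.mul_left ?_ _
      have h3 : p ∣ (∑ t ∈ range (p ^ (m + 1)), t) * 2 := by
        rw [sum_range_id_mul_two]
        exact (dvd_pow_self p m.succ_ne_zero).mul_right _
      exact (Nat.Coprime.dvd_mul_right hodd.coprime_two_right).mp h3
  set X := ∏ j ∈ range (p ^ i), partialNorm s j x with hX
  set y := partialNorm s (p ^ i) x with hy
  have hyfix : s • y = y := by
    rw [← div_eq_one, hy, partialNorm.smul_div, hx, div_self']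
  have hW : ∏ j ∈ range (p ^ (i + m + 1)), partialNorm s j x = (X ^ p ^ m * y ^ e) ^ p := by
    rw [add_assoc, pow_add, prod_apply_mul hx, he, mul_pow, ← pow_mul, ← pow_mul, mul_comm e,
      pow_succ]
  rw [h.isNormPow_iff (N := p ^ (i + m)) (pow_succ' _ _) hδ hW, smul_mul', smul_pow', smul_pow',
    hyfix, mul_div_mul_right_eq_div, ← div_pow, hX, smul_div_prod, div_pow, ← pow_mul, ← pow_add,
    mul_div_cancel, show i + m + 1 - i - 1 = m by omega]

theorem exists_norm_mul_eq_root_of_level (h : IsCyclicKummer p n s ξ) {i : ℕ} (hi : i < n)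
    (h2 : p = 2 → n ≠ 1) {δ x k : M} (hx : s ^ p ^ i • x = x) (hδ : s • δ / δ = x * k ^ p)
    (hnp : ¬ IsNormPow p n s δ) :
    ∃ x' k' : M, s ^ p ^ i • x' = x' ∧
      partialNorm s (p ^ i) x' ^ p ^ (n - i - 1) * partialNorm s (p ^ n) k' = ξ := by
  rw [h.isNormPow_iff_of_smul_div_eq hi h2 hx hδ] at hnp
  obtain ⟨m, rfl⟩ := Nat.exists_eq_add_of_lt hi
  have h1 : partialNorm s (p ^ (i + m + 1)) (x * k ^ p) = 1 := by
    rw [← hδ, apply_smul_div, h.pow_eq_one, one_smul, div_self']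
  have hNx : partialNorm s (p ^ (i + m + 1)) x = partialNorm s (p ^ i) x ^ p ^ (m + 1) := by
    rw [add_assoc, pow_add, mul_apply, of_fixed]
    rw [smul_of_commute ((Commute.refl s).pow_left _), hx]
  obtain ⟨d, hd⟩ := h.exists_pow_eq _ (by
    rw [show i + m + 1 - i - 1 = m by omega, mul_pow, ← pow_mul, ← pow_succ, ← hNx, ← map_pow,
      ← map_mul, h1]) hnp
  refine ⟨x ^ d, k ^ d, by rw [smul_pow', hx], ?_⟩
  rw [← hd, map_pow, map_pow, mul_pow, ← pow_mul, ← pow_mul, mul_comm d]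

theorem exists_level_of_norm_mul_eq_root (h : IsCyclicKummer p n s ξ) {i : ℕ} (hi : i < n)
    (h2 : p = 2 → n ≠ 1) {x k : M} (hx : s ^ p ^ i • x = x)
    (hxk : partialNorm s (p ^ i) x ^ p ^ (n - i - 1) * partialNorm s (p ^ n) k = ξ) :
    ∃ δ : M, s • δ / δ = x * k ^ p ∧ ¬ IsNormPow p n s δ := by
  obtain ⟨δ, hδ⟩ := h.hilbert90_zero (x := x * k ^ p) (by
    obtain ⟨m, rfl⟩ := Nat.exists_eq_add_of_lt hi
    rw [map_mul, map_pow, ← h.root_pow, ← hxk, mul_pow, ← pow_mul, ← pow_succ,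
      show i + m + 1 - i - 1 + 1 = m + 1 by omega, add_assoc, pow_add p i, mul_apply s _ _ x, of_fixed]
    rw [smul_of_commute ((Commute.refl s).pow_left _), hx])
  refine ⟨δ, hδ, ?_⟩
  rw [h.isNormPow_iff_of_smul_div_eq hi h2 hx hδ, hxk]
  exact h.root_ne

/-- Both v and sα/α have norm ξ from level i to the ground, so Hilbert 90 gives v = s(α/c)/(α/c)
with c in level i. Since v is also the norm of u to level i + 1, a partial norm of u of length p^i
has norm s^{p^i}(α/c)/(α/c) = ξ. -/
theorem isRootNorm_succ_of_norm_mul_eq_root (h : IsCyclicKummer p n s ξ) {i : ℕ} (hi : i < n)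
    {x k : M} (hx : s ^ p ^ i • x = x)
    (hxk : partialNorm s (p ^ i) x ^ p ^ (n - i - 1) * partialNorm s (p ^ n) k = ξ) :
    IsRootNorm p n s ξ (i + 1) := by
  obtain ⟨α, hα, hα'⟩ := h.exists_kummer_generator hi
  obtain ⟨m, rfl⟩ := Nat.exists_eq_add_of_lt hi
  have hcard : p ^ (i + m + 1) = p ^ i * p ^ (m + 1) := by rw [add_assoc, pow_add]
  rw [show i + m + 1 - i - 1 = m by omega] at hxk
  set v := x ^ p ^ m * partialNorm (s ^ p ^ i) (p ^ (m + 1)) k with hv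
  obtain ⟨c, hc, hcv⟩ := h.hilbert90_fixed (x := (s • α / α) / v) hi.le (by
      rw [map_div, apply_smul_div, hα, mul_div_cancel_right, hv, map_mul, ← mul_apply', map_pow,
        ← hcard, hxk, div_self'])
  set u := x * partialNorm (s ^ p ^ i) p k with hu
  have huv : partialNorm (s ^ p ^ (i + 1)) (p ^ m) u = v := by
    have hx' : s ^ p ^ (i + 1) • x = x := by
      rw [pow_succ, pow_mul]
      exact pow_smul_eq_self hx p
    rw [hu, map_mul, of_fixed hx', pow_succ, pow_mul, ← mul_apply, ← pow_succ', hv]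
  have hα2 : s • (α / c) / (α / c) = v := by
    rw [smul_div', div_div_div_comm, hcv, div_div_cancel]
  refine ⟨partialNorm s (p ^ i) u, ?_⟩
  rw [show i + m + 1 - (i + 1) = m by omega]
  have : partialNorm (s ^ p ^ (i + 1)) (p ^ m) (partialNorm s (p ^ i) u) =
      partialNorm s (p ^ i) (partialNorm (s ^ p ^ (i + 1)) (p ^ m) u) := by
    simp only [apply_eq (s ^ p ^ (i + 1)), map_prod]
    refine prod_congr rfl fun j _ => smul_of_commute ?_ _ u
    exact ((Commute.refl s).pow_left _).pow_left j
  rw [this, huv, ← hα2, apply_smul_div, smul_div', hα, hc, div_div_div_cancel_right,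
    mul_div_cancel_right]

/-- Reverses the previous argument: two uses of Hilbert 90 split u = sl/l as z times a partial norm
of w, with z in level i. -/
theorem exists_norm_mul_eq_root_of_isRootNorm_succ (h : IsCyclicKummer p n s ξ) {i : ℕ} (hi : i < n)
    (hr : IsRootNorm p n s ξ (i + 1)) :
    ∃ x k : M, s ^ p ^ i • x = x ∧
      partialNorm s (p ^ i) x ^ p ^ (n - i - 1) * partialNorm s (p ^ n) k = ξ := by
  obtain ⟨k₀, hk₀⟩ := hr
  obtain ⟨α, hα, hα'⟩ := h.exists_kummer_generator hi
  obtain ⟨m, rfl⟩ := Nat.exists_eq_add_of_lt hi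
  rw [show i + m + 1 - (i + 1) = m by omega] at hk₀
  rw [show i + m + 1 - i - 1 = m by omega]
  have hcard : p ^ (i + m + 1) = p ^ i * p ^ (m + 1) := by rw [add_assoc, pow_add]
  set ρ := s ^ p ^ i with hρ
  have hρp : s ^ p ^ (i + 1) = ρ ^ p := by rw [hρ, ← pow_mul, ← pow_succ]
  have hcomm : Commute ρ (ρ ^ p) := (Commute.refl ρ).pow_right p
  have hcs : Commute s (ρ ^ p) := ((Commute.refl s).pow_right _).pow_right p
  rw [hρp] at hk₀ hα'
  have hH (x : M) (hx : partialNorm ρ (p ^ (m + 1)) x = 1) : ∃ l : M, ρ • l / l = x :=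
    h.hilbert90 i hi.le x (by rwa [show i + m + 1 - i = m + 1 by omega])
  have hH' (x : M) (hx : partialNorm (ρ ^ p) (p ^ m) x = 1) : ∃ l : M, ρ ^ p • l / l = x := by
    rw [← hρp] at hx ⊢
    exact h.hilbert90 (i + 1) (by omega) x (by rwa [show i + m + 1 - (i + 1) = m by omega])
  obtain ⟨l, hl⟩ := hH k₀ (by
    rw [pow_succ', mul_apply', hk₀, of_fixed (h.smul_root_pow _), h.root_pow])
  set c := α / partialNorm (ρ ^ p) (p ^ m) l with hc
  have hcfix : ρ • c = c := by
    rw [hc, smul_div', hα, smul_of_commute hcomm, ← div_eq_one, div_div_div_comm, mul_div_cancel_right,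
      ← map_div, hl, hk₀, div_self']
  set u := s • l / l with hu
  have hNu : partialNorm (ρ ^ p) (p ^ m) u = (s • α / α) / (s • c / c) := by
    have hsc : s • c / c = (s • α / α) /
        (s • partialNorm (ρ ^ p) (p ^ m) l / partialNorm (ρ ^ p) (p ^ m) l) := by
      rw [hc, smul_div', div_div_div_comm]
    rw [hu, map_div, ← smul_of_commute hcs, hsc, div_div_cancel]
  have hbfix : ρ • (s • α / α) = s • α / α := by
    rw [smul_div', ← mul_smul, hρ, ← pow_succ, pow_succ', mul_smul, hα, smul_mul',
      h.smul_root ξ h.root_pow, mul_div_mul_left_eq_div]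
  have hscfix : ρ • (s • c / c) = s • c / c := by
    rw [smul_div', ← mul_smul, hρ, ← pow_succ, pow_succ', mul_smul, ← hρ, hcfix]
  -- The norm of u to level i + 1 lies in level i, so ρu/u has norm 1.
  obtain ⟨w, hw⟩ := hH' (ρ • u / u) (by
    rw [map_div, ← smul_of_commute hcomm, hNu, smul_div', hbfix, hscfix, div_self'])
  set z := u / partialNorm ρ p w with hz
  have hzfix : ρ • z = z := by
    rw [hz, smul_div', ← div_eq_one, div_div_div_comm, partialNorm.smul_div, hw, div_self']
  have hzfix' : ρ ^ p • z = z := pow_smul_eq_self hzfix p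
  refine ⟨z, w, hzfix, ?_⟩
  rw [hcard, mul_apply', ← map_pow, ← map_mul, ← of_fixed hzfix', pow_succ' p m, mul_apply ρ,
    ← map_mul, hz, div_mul_cancel, hNu, map_div, apply_smul_div, apply_smul_div, hα, hcfix,
    mul_div_cancel_right, div_self', div_one]

theorem isRootNorm_mono (h : IsCyclicKummer p n s ξ) {i j : ℕ} (hij : i ≤ j) (hj : j ≤ n)
    (hr : IsRootNorm p n s ξ i) : IsRootNorm p n s ξ j := by
  obtain ⟨k, hk⟩ := hr
  obtain ⟨a, rfl⟩ := Nat.exists_eq_add_of_le hij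
  obtain ⟨b, rfl⟩ := Nat.exists_eq_add_of_le hj
  refine ⟨partialNorm (s ^ p ^ i) (p ^ a) k, ?_⟩
  rw [pow_add, pow_mul, ← mul_apply, ← pow_add, ← hk]
  congr 2
  congr 1
  omega

theorem isRootNorm_self (p n : ℕ) (s : G) (ξ : M) : IsRootNorm p n s ξ n := ⟨ξ, by simp⟩

theorem exists_level_iff (h : IsCyclicKummer p n s ξ) {i : ℕ} (hi : i < n) (h2 : p = 2 → n ≠ 1) :
    (∃ δ : M, ¬ IsNormPow p n s δ ∧ ∃ x k, s ^ p ^ i • x = x ∧ s • δ / δ = x * k ^ p) ↔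
      IsRootNorm p n s ξ (i + 1) := by
  constructor
  · rintro ⟨δ, hnp, x, k, hx, hδ⟩
    obtain ⟨x', k', hx', hxk⟩ := h.exists_norm_mul_eq_root_of_level hi h2 hx hδ hnp
    exact h.isRootNorm_succ_of_norm_mul_eq_root hi hx' hxk
  · intro hr
    obtain ⟨x, k, hx, hxk⟩ := h.exists_norm_mul_eq_root_of_isRootNorm_succ hi hr
    obtain ⟨δ, hδ, hnp⟩ := h.exists_level_of_norm_mul_eq_root hi h2 hx hxk
    exact ⟨δ, hnp, x, k, hx, hδ⟩

theorem exists_bot_level_iff (h : IsCyclicKummer p n s ξ) (hn : 1 ≤ n) :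
    (∃ δ : M, ¬ IsNormPow p n s δ ∧ ∃ k, s • δ / δ = k ^ p) ↔ IsRootNorm p n s ξ 0 := by
  simp only [IsRootNorm, pow_zero, pow_one, tsub_zero]
  constructor
  · rintro ⟨δ, hnp, k, hδ⟩
    rw [h.isNormPow_iff_of_smul_div_eq_pow hn hδ] at hnp
    obtain ⟨d, hd⟩ := h.exists_pow_eq _ (by
      rw [← map_pow, ← hδ, apply_smul_div, h.pow_eq_one, one_smul, div_self']) hnp
    exact ⟨k ^ d, by rw [map_pow, hd]⟩
  · rintro ⟨k, hk⟩
    obtain ⟨δ, hδ⟩ := h.hilbert90_zero (x := k ^ p) (by rw [map_pow, hk, h.root_pow])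
    refine ⟨δ, ?_, k, hδ⟩
    rw [h.isNormPow_iff_of_smul_div_eq_pow hn hδ, hk]
    exact h.root_ne

/-- In degree two, the level zero is attained unless a square root of `ξ = -1` generates. -/
theorem exists_level_zero_of_degree_two (h : IsCyclicKummer 2 1 s ξ)
    (hsq : ∀ u : M, u ^ 2 = ξ → s • u = u) :
    ∃ δ : M, ¬ IsNormPow 2 1 s δ ∧ ∃ x k, s ^ 2 ^ 0 • x = x ∧ s • δ / δ = x * k ^ 2 := by
  obtain ⟨α, hα, -⟩ := h.exists_kummer_generator one_pos
  rw [pow_zero, pow_one] at hα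
  have hξ := h.smul_root ξ h.root_pow
  -- Here ξ = -1 and N(α) = -α²; were this f² with f fixed, f/α would be a square root of -1 that is
  -- not fixed.
  refine ⟨α, ?_, ξ, 1, by simpa using hξ, by simp [hα]⟩
  rintro ⟨f, hf, hfα⟩
  have h1 : ξ * α ^ 2 = f ^ 2 := by
    rw [← hfα, apply_eq, pow_one, prod_range_succ, prod_range_one, pow_zero, one_smul, pow_one, hα,
      mul_left_comm, sq]
  have h2 := hsq (f / α) (by rw [div_pow, ← h1, mul_div_cancel_right])
  rw [smul_div', hf, hα, div_right_inj, mul_eq_right] at h2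
  exact h.root_ne h2

end IsCyclicKummer

/-! ### From Galois extensions to the abstract setting -/

section

open Finset

variable {F K : Type*} [Field F] [Field K] [Algebra F K]

theorem val_partialNorm (g : Gal(K/F)) (q : ℕ) (x : Kˣ) :
    ((partialNorm g q x : Kˣ) : K) = ∏ j ∈ range q, (g ^ j) (x : K) := by
  simp [partialNorm.apply_eq, AlgEquiv.smul_units_def]

/-- Hilbert's Theorem 90 for the extension of the fixed field of an automorphism `g`. -/
theorem exists_smul_div_eq_of_partialNorm_eq_one {g : Gal(K/F)} {x : Kˣ} (hg : 0 < orderOf g)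
    (hx : partialNorm g (orderOf g) x = 1) : ∃ l : Kˣ, g • l / l = x := by
  set r := orderOf g with hr
  -- A Lagrange resolvent, nonzero somewhere by independence of characters. It satisfies x · g(Sθ) =
  -- Sθ, hence the inverse in the witness below.
  let S : K → K := fun θ => ∑ j ∈ range r, ((partialNorm g j x : Kˣ) : K) * (g ^ j) θ
  obtain ⟨θ, hθ⟩ : ∃ θ, S θ ≠ 0 := by
    by_contra! hS
    have hinj : Function.Injective fun j : Fin r => ((g ^ (j : ℕ) : Gal(K/F)) : K →* K) := by
      intro i j hij
      refine Fin.ext (pow_injOn_Iio_orderOf (x := g) i.2 j.2 ?_)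
      ext θ
      exact DFunLike.congr_fun hij θ
    have hli := (linearIndependent_monoidHom K K).comp _ hinj
    rw [Fintype.linearIndependent_iff] at hli
    have := hli (fun j => ((partialNorm g j x : Kˣ) : K)) (by
      ext θ
      simpa [S, sum_range, Finset.sum_apply] using hS θ) ⟨0, hg⟩
    simp at this
  have hshift : (x : K) * g (S θ) = S θ := by
    have hstep : ∀ j, (x : K) * (g ((partialNorm g j x : Kˣ) : K) * g ((g ^ j) θ)) =
        ((partialNorm g (j + 1) x : Kˣ) : K) * (g ^ (j + 1)) θ := by
      intro j
      rw [add_comm j 1, partialNorm.add_apply, ← mul_assoc, pow_add]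
      simp [AlgEquiv.smul_units_def]
    simp only [S, map_sum, map_mul, mul_sum, hstep]
    have h := sum_range_succ' (fun j => ((partialNorm g j x : Kˣ) : K) * (g ^ j) θ) r
    rw [sum_range_succ, hx, hr, pow_orderOf_eq_one] at h
    simpa using h.symm
  refine ⟨(Units.mk0 (S θ) hθ)⁻¹, ?_⟩
  rw [smul_inv', inv_div_inv, div_eq_iff_eq_mul]
  ext
  simpa [AlgEquiv.smul_units_def] using hshift.symm

theorem isCyclicKummer_of_orderOf_eq {p n : ℕ} (hp : p.Prime) {σ : Gal(K/F)}
    (hσ : orderOf σ = p ^ n) {ξ : Fˣ} (hξ : IsPrimitiveRoot ξ p) :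
    IsCyclicKummer p n σ (Units.map (algebraMap F K : F →* K) ξ) := by
  have hξK : IsPrimitiveRoot (Units.map (algebraMap F K : F →* K) ξ) p :=
    hξ.map_of_injective (Units.map_injective (algebraMap F K).injective)
  have hpow : ∀ {η : Kˣ}, IsPrimitiveRoot η p → ∀ ζ : Kˣ, ζ ^ p = 1 → ∃ d : ℕ, η ^ d = ζ := by
    intro η hη ζ hζ
    have := NeZero.mk hp.ne_zero
    obtain ⟨d, -, hd⟩ := (IsPrimitiveRoot.coe_units_iff.mpr hη).eq_pow_of_pow_eq_one
      (ξ := (ζ : K)) (by rw [← Units.val_pow_eq_pow_val, hζ, Units.val_one])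
    exact ⟨d, Units.ext (by simpa using hd)⟩
  refine ⟨hp, by rw [← hσ, pow_orderOf_eq_one], ?_, ?_, ?_, hξK.pow_eq_one, hξK.ne_one hp.one_lt⟩
  · intro i hi x hx
    have hord : orderOf (σ ^ p ^ i) = p ^ (n - i) := by
      rw [orderOf_pow_of_dvd (pow_pos hp.pos i).ne' (hσ ▸ pow_dvd_pow p hi), hσ,
        Nat.pow_div hi hp.pos]
    exact exists_smul_div_eq_of_partialNorm_eq_one (hord ▸ pow_pos hp.pos _) (hord ▸ hx)
  · intro ζ hζ
    obtain ⟨d, rfl⟩ := hpow hξK ζ hζ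
    ext
    simp [AlgEquiv.smul_units_def]
  · intro ζ hζ hζ1
    have := Fact.mk hp
    have hprim : IsPrimitiveRoot ζ p := orderOf_eq_prime hζ hζ1 ▸ IsPrimitiveRoot.orderOf ζ
    exact hpow hprim _ hξK.pow_eq_one

theorem powerClass_eq_iff {p : ℕ} {a b : Kˣ} :
    powerClass p a = powerClass p b ↔ ∃ k : Kˣ, a = b * k ^ p := by
  rw [powerClass, powerClass, eq_comm, QuotientGroup.eq]
  constructor
  · rintro ⟨k, hk⟩
    exact ⟨k, by rw [← powMonoidHom_apply, hk, mul_inv_cancel_left]⟩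
  · rintro ⟨k, rfl⟩
    exact ⟨k, by simp⟩

theorem powerClass_div {p : ℕ} (a b : Kˣ) :
    powerClass p (a / b) = powerClass p a / powerClass p b := rfl

variable {p n : ℕ} {σ : Gal(K/F)}

theorem orderOf_generator (hσ : ∀ τ, τ ∈ Subgroup.zpowers σ) (hcard : Nat.card Gal(K/F) = p ^ n) :
    orderOf σ = p ^ n := by
  rw [orderOf_eq_card_of_forall_mem_zpowers hσ, hcard]

variable [FiniteDimensional F K] [IsGalois F K]

theorem exists_algebraMap_eq_of_smul_eq (hσ : ∀ τ, τ ∈ Subgroup.zpowers σ) {x : K}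
    (hx : σ x = x) : ∃ f : F, algebraMap F K f = x := by
  refine (IsGalois.mem_range_algebraMap_iff_fixed x).mpr fun τ => ?_
  exact (Subgroup.zpowers_le.mpr (show σ ∈ MulAction.stabilizer Gal(K/F) x from hx)) (hσ τ)

theorem algebraMap_norm_eq (hσ : ∀ τ, τ ∈ Subgroup.zpowers σ) (x : K) :
    algebraMap F K (Algebra.norm F x) = ∏ j ∈ range (orderOf σ), (σ ^ j) x := by
  rw [Algebra.norm_eq_prod_automorphisms, prod_range]
  refine (Fintype.prod_bijective (fun j : Fin (orderOf σ) => σ ^ (j : ℕ)) ⟨?_, ?_⟩ _ _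
    fun _ => rfl).symm
  · exact fun i j hij => Fin.ext (pow_injOn_Iio_orderOf (x := σ) i.2 j.2 hij)
  · intro τ
    classical
    obtain ⟨j, hj, rfl⟩ := Finset.mem_image.mp (mem_zpowers_iff_mem_range_orderOf.mp (hσ τ))
    exact ⟨⟨j, mem_range.mp hj⟩, rfl⟩

theorem map_norm_eq_partialNorm (hσ : ∀ τ, τ ∈ Subgroup.zpowers σ)
    (hcard : Nat.card Gal(K/F) = p ^ n) (δ : Kˣ) :
    Units.map (algebraMap F K : F →* K) (Units.map (Algebra.norm F : K →* F) δ) =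
      partialNorm σ (p ^ n) δ := by
  ext
  rw [val_partialNorm, ← orderOf_generator hσ hcard, ← algebraMap_norm_eq hσ]
  rfl

theorem powerClass_norm_eq_one_iff (hσ : ∀ τ, τ ∈ Subgroup.zpowers σ)
    (hcard : Nat.card Gal(K/F) = p ^ n) (δ : Kˣ) :
    powerClass p (Units.map (Algebra.norm F : K →* F) δ) = powerClass p (1 : Fˣ) ↔
      IsNormPow p n σ δ := by
  have hinj : Function.Injective (Units.map (algebraMap F K : F →* K)) :=
    Units.map_injective (algebraMap F K).injective
  rw [powerClass_eq_iff]
  simp only [one_mul]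
  constructor
  · rintro ⟨f, hf⟩
    refine ⟨Units.map (algebraMap F K : F →* K) f, ?_, ?_⟩
    · ext
      simp [AlgEquiv.smul_units_def]
    · rw [← map_norm_eq_partialNorm hσ hcard, hf, map_pow]
  · rintro ⟨f, hf, hδ⟩
    obtain ⟨f', hf'⟩ := exists_algebraMap_eq_of_smul_eq hσ (x := (f : K)) (by
      simpa [AlgEquiv.smul_units_def] using congrArg Units.val hf)
    have h0 : f' ≠ 0 := by
      rintro rfl
      exact f.ne_zero (by simpa using hf'.symm)
    refine ⟨Units.mk0 f' h0, hinj ?_⟩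
    rw [map_norm_eq_partialNorm hσ hcard, hδ, map_pow]
    congr 1
    ext
    exact hf'.symm

/-- The fixing subgroup of E has index p^i, so it contains σ^{p^i}; comparing orders shows that this
element generates it. -/
theorem mem_intermediateField_iff (hp : p.Prime) (hσ : ∀ τ, τ ∈ Subgroup.zpowers σ)
    (hcard : Nat.card Gal(K/F) = p ^ n) {i : ℕ} (hi : i ≤ n) {E : IntermediateField F K}
    (hE : Module.finrank F E = p ^ i) {x : K} : x ∈ E ↔ (σ ^ p ^ i) x = x := by
  have hcomm : ∀ a b : Gal(K/F), a * b = b * a := by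
    intro a b
    obtain ⟨u, rfl⟩ := hσ a
    obtain ⟨v, rfl⟩ := hσ b
    exact zpow_mul_comm σ u v
  have hindex : E.fixingSubgroup.index = p ^ i := by
    rw [← IntermediateField.finrank_eq_fixingSubgroup_index, hE]
  have : E.fixingSubgroup.Normal := ⟨fun a ha b => by rwa [hcomm b a, mul_inv_cancel_right]⟩
  have hmem : σ ^ p ^ i ∈ E.fixingSubgroup := hindex ▸ E.fixingSubgroup.pow_index_mem σ
  have hz : Subgroup.zpowers (σ ^ p ^ i) = E.fixingSubgroup := by
    refine Subgroup.eq_of_le_of_card_ge (Subgroup.zpowers_le.mpr hmem) ?_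
    have h1 := E.fixingSubgroup.card_mul_index
    rw [hindex, hcard] at h1
    rw [Nat.card_zpowers, orderOf_pow_of_dvd (pow_pos hp.pos i).ne'
      (orderOf_generator hσ hcard ▸ pow_dvd_pow p hi), orderOf_generator hσ hcard]
    exact ((Nat.div_eq_of_eq_mul_left (pow_pos hp.pos i) h1.symm).symm).le
  constructor
  · exact fun hx => hmem ⟨x, hx⟩
  · intro hx
    rw [← IsGalois.fixedField_fixingSubgroup E, ← hz]
    rintro ⟨τ, hτ⟩
    exact (Subgroup.zpowers_le.mpr
      (show σ ^ p ^ i ∈ MulAction.stabilizer Gal(K/F) x from hx)) hτ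

theorem exists_intermediateField (hp : p.Prime) (hσ : ∀ τ, τ ∈ Subgroup.zpowers σ)
    (hcard : Nat.card Gal(K/F) = p ^ n) {i : ℕ} (hi : i ≤ n) :
    ∃ E : IntermediateField F K, Module.finrank F E = p ^ i := by
  refine ⟨IntermediateField.fixedField (Subgroup.zpowers (σ ^ p ^ i)), ?_⟩
  have h1 := (Subgroup.zpowers (σ ^ p ^ i)).card_mul_index
  rw [IntermediateField.finrank_eq_fixingSubgroup_index, IntermediateField.fixingSubgroup_fixedField]
  rw [hcard, Nat.card_zpowers, orderOf_pow_of_dvd (pow_pos hp.pos i).ne'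
      (orderOf_generator hσ hcard ▸ pow_dvd_pow p hi), orderOf_generator hσ hcard,
      Nat.pow_div hi hp.pos] at h1
  refine Nat.eq_of_mul_eq_mul_left (pow_pos hp.pos (n - i)) ?_
  rw [h1, ← pow_add, Nat.sub_add_cancel hi]

theorem mem_levelClasses_iff (hp : p.Prime) (hσ : ∀ τ, τ ∈ Subgroup.zpowers σ)
    (hcard : Nat.card Gal(K/F) = p ^ n) {i : ℕ} (hi : i ≤ n) (γ : Kˣ) :
    powerClass p γ ∈ levelClasses p F K (i : WithBot ℕ) ↔
      ∃ x k : Kˣ, σ ^ p ^ i • x = x ∧ γ = x * k ^ p := by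
  change (∃ E : IntermediateField F K, Module.finrank F E = p ^ i ∧
      ∃ x : Eˣ, _ = powerClass p (Units.map (algebraMap E K : E →* K) x)) ↔ _
  simp only [powerClass_eq_iff]
  constructor
  · rintro ⟨E, hE, x, k, hγ⟩
    refine ⟨_, k, ?_, hγ⟩
    ext
    exact (mem_intermediateField_iff hp hσ hcard hi hE).mp (x : E).2
  · rintro ⟨x, k, hx, hγ⟩
    obtain ⟨E, hE⟩ := exists_intermediateField hp hσ hcard hi
    have hxE := (mem_intermediateField_iff hp hσ hcard hi hE).mpr
      (by simpa [AlgEquiv.smul_units_def] using congrArg Units.val hx)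
    refine ⟨E, hE, Units.mk0 ⟨x, hxE⟩ fun h => x.ne_zero (congrArg Subtype.val h), k, ?_⟩
    rw [hγ]
    congr 1
    ext
    rfl

theorem smul_div_eq_of_smul_div_eq_mul_pow {G M : Type*} [Group G] [CommGroup M]
    [MulDistribMulAction G M] {g : G} {δ x k : M} (h : g • δ / δ = x * k ^ p) (t : ℕ) :
    g ^ t • δ / δ = partialNorm g t x * partialNorm g t k ^ p := by
  rw [← partialNorm.apply_smul_div, h, map_mul, map_pow]

/-- Testing σ suffices: for σ^t, x and k are replaced by their t-th partial norms, and x stays in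
level i. -/
theorem isLevelOf_coe_iff (hp : p.Prime) (hσ : ∀ τ, τ ∈ Subgroup.zpowers σ)
    (hcard : Nat.card Gal(K/F) = p ^ n) {i : ℕ} (hi : i ≤ n) (δ : Kˣ) :
    IsLevelOf p F K (i : WithBot ℕ) δ ↔
      ¬ IsNormPow p n σ δ ∧ ∃ x k : Kˣ, σ ^ p ^ i • x = x ∧ σ • δ / δ = x * k ^ p := by
  rw [IsLevelOf, Ne, powerClass_norm_eq_one_iff hσ hcard]
  refine and_congr_right fun _ => ?_
  simp only [← powerClass_div]
  constructor
  · exact fun h => (mem_levelClasses_iff hp hσ hcard hi _).mp (h σ)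
  · rintro ⟨x, k, hx, hδ⟩ τ
    obtain ⟨t, rfl⟩ := mem_powers_iff_mem_zpowers.mpr (hσ τ)
    refine (mem_levelClasses_iff hp hσ hcard hi _).mpr
      ⟨_, _, ?_, smul_div_eq_of_smul_div_eq_mul_pow hδ t⟩
    rw [partialNorm.smul_of_commute ((Commute.refl σ).pow_left _), hx]

theorem isLevelOf_bot_iff (hσ : ∀ τ, τ ∈ Subgroup.zpowers σ)
    (hcard : Nat.card Gal(K/F) = p ^ n) (δ : Kˣ) :
    IsLevelOf p F K ⊥ δ ↔ ¬ IsNormPow p n σ δ ∧ ∃ k : Kˣ, σ • δ / δ = k ^ p := by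
  have hbot (γ : Kˣ) : powerClass p γ ∈ levelClasses p F K ⊥ ↔ ∃ k : Kˣ, γ = k ^ p := by
    change powerClass p γ = powerClass p 1 ↔ _
    simp [powerClass_eq_iff]
  rw [IsLevelOf, Ne, powerClass_norm_eq_one_iff hσ hcard]
  refine and_congr_right fun _ => ?_
  simp only [← powerClass_div]
  constructor
  · exact fun h => (hbot _).mp (h σ)
  · rintro ⟨k, hδ⟩ τ
    obtain ⟨t, rfl⟩ := mem_powers_iff_mem_zpowers.mpr (hσ τ)
    refine (hbot _).mpr ⟨partialNorm σ t k, ?_⟩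
    have := smul_div_eq_of_smul_div_eq_mul_pow (hδ.trans (one_mul _).symm) t
    simpa using this

theorem isFieldIndex_bot (hp : p.Prime) (hσ : ∀ τ, τ ∈ Subgroup.zpowers σ)
    (hcard : Nat.card Gal(K/F) = p ^ n) (hn : 1 ≤ n) {ξ : Fˣ} (hξ : IsPrimitiveRoot ξ p)
    (h0 : IsRootNorm p n σ (Units.map (algebraMap F K : F →* K) ξ) 0) : IsFieldIndex p F K ⊥ := by
  have hK := isCyclicKummer_of_orderOf_eq hp (orderOf_generator hσ hcard) hξ
  refine ⟨?_, fun _ _ => bot_le⟩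
  obtain ⟨δ, hδ⟩ := (hK.exists_bot_level_iff hn).mpr h0
  exact ⟨δ, (isLevelOf_bot_iff hσ hcard δ).mpr hδ⟩

/-- The invariant is one less than the least level from which the root of unity is a norm. -/
theorem isFieldIndex_coe (hp : p.Prime) (hσ : ∀ τ, τ ∈ Subgroup.zpowers σ)
    (hcard : Nat.card Gal(K/F) = p ^ n) {ξ : Fˣ} (hξ : IsPrimitiveRoot ξ p)
    (hsq : p = 2 → n = 1 → ∀ u : Kˣ, u ^ 2 = Units.map (algebraMap F K : F →* K) ξ → σ • u = u)
    {i : ℕ} (hi : i < n) (hr : IsRootNorm p n σ (Units.map (algebraMap F K : F →* K) ξ) (i + 1))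
    (hmin : ∀ j ≤ i, ¬ IsRootNorm p n σ (Units.map (algebraMap F K : F →* K) ξ) j) :
    IsFieldIndex p F K (i : WithBot ℕ) := by
  have hK := isCyclicKummer_of_orderOf_eq hp (orderOf_generator hσ hcard) hξ
  constructor
  · simp only [Set.mem_ofPred_eq, isLevelOf_coe_iff hp hσ hcard hi.le]
    by_cases h2 : p = 2 → n ≠ 1
    · exact (hK.exists_level_iff hi h2).mpr hr
    · push Not at h2
      obtain ⟨rfl, rfl⟩ := h2
      obtain rfl : i = 0 := by omega
      exact hK.exists_level_zero_of_degree_two (hsq rfl rfl)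
  · rintro (_ | j) ⟨δ, hδ⟩
    · exact absurd ((hK.exists_bot_level_iff (by omega)).mp
        ⟨δ, (isLevelOf_bot_iff hσ hcard δ).mp hδ⟩) (hmin 0 i.zero_le)
    · refine WithBot.coe_le_coe.mpr ?_
      by_contra! hj
      have hδ' := (isLevelOf_coe_iff hp hσ hcard (hj.le.trans hi.le) δ).mp hδ
      have hlt : j < i := hj
      -- Here j < i < n forces n ≥ 2, so the degree-two exception cannot occur.
      refine hmin (j + 1) hlt ((hK.exists_level_iff (hlt.trans hi) fun _ => ?_).mp ⟨δ, hδ'⟩)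
      omega

end

/-! ### Change of base and subextensions -/

section

theorem partialNorm_eq_of_smul_eq {G H M : Type*} [Group G] [Group H] [CommGroup M]
    [MulDistribMulAction G M] [MulDistribMulAction H M] {g : G} {h : H}
    (hgh : ∀ x : M, g • x = h • x) (a q : ℕ) (x : M) :
    partialNorm (g ^ a) q x = partialNorm (h ^ a) q x := by
  have hpow : ∀ (t : ℕ) (x : M), g ^ t • x = h ^ t • x := by
    intro t
    induction t with
    | zero => simp
    | succ t ih => intro x; rw [pow_succ', pow_succ', mul_smul, mul_smul, ih, hgh]
  simp only [partialNorm.apply_eq, ← pow_mul, hpow]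

theorem isRootNorm_subextension_iff {G H M : Type*} [Group G] [Group H] [CommGroup M]
    [MulDistribMulAction G M] [MulDistribMulAction H M] {p n j : ℕ} {g : G} {h : H}
    (hgh : ∀ x : M, h • x = g ^ p ^ j • x) (ξ : M) (i : ℕ) :
    IsRootNorm p (n - j) h ξ i ↔ IsRootNorm p n g ξ (j + i) := by
  simp only [IsRootNorm, partialNorm_eq_of_smul_eq hgh, ← pow_mul, ← pow_add, Nat.sub_sub]

variable {F K : Type*} [Field F] [Field K] [Algebra F K] [FiniteDimensional F K] [IsGalois F K]
  {p n : ℕ} {σ : Gal(K/F)}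

/-- The Galois group over the `j`-th level is generated by `σ ^ p ^ j`. -/
theorem exists_generator_over_intermediateField (hp : p.Prime)
    (hσ : ∀ τ, τ ∈ Subgroup.zpowers σ) (hcard : Nat.card Gal(K/F) = p ^ n) {j : ℕ} (hj : j ≤ n)
    {E : IntermediateField F K} (hE : Module.finrank F E = p ^ j) :
    ∃ ρ : Gal(K/E), (∀ τ, τ ∈ Subgroup.zpowers ρ) ∧ Nat.card Gal(K/E) = p ^ (n - j) ∧
      ∀ x : Kˣ, ρ • x = σ ^ p ^ j • x := by
  have hmem : σ ^ p ^ j ∈ E.fixingSubgroup := by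
    rintro ⟨x, hx⟩
    exact (mem_intermediateField_iff hp hσ hcard hj hE).mp hx
  have hcardE : Nat.card Gal(K/E) = p ^ (n - j) := by
    have h1 := Module.finrank_mul_finrank F E K
    rw [← IsGalois.card_aut_eq_finrank F K, ← IsGalois.card_aut_eq_finrank E K, hcard, hE] at h1
    refine Nat.eq_of_mul_eq_mul_left (pow_pos hp.pos j) ?_
    rw [h1, ← pow_add, Nat.add_sub_cancel' hj]
  set ρ := IntermediateField.fixingSubgroupEquiv E ⟨σ ^ p ^ j, hmem⟩ with hρ
  have hord : orderOf ρ = p ^ (n - j) := by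
    rw [hρ, MulEquiv.orderOf_eq, Subgroup.orderOf_mk, orderOf_pow_of_dvd (pow_pos hp.pos j).ne'
      (orderOf_generator hσ hcard ▸ pow_dvd_pow p hj), orderOf_generator hσ hcard,
      Nat.pow_div hj hp.pos]
  refine ⟨ρ, fun τ => ?_, hcardE, fun x => rfl⟩
  have htop : Subgroup.zpowers ρ = ⊤ :=
    Subgroup.eq_top_of_card_eq _ (by rw [Nat.card_zpowers, hord, hcardE])
  rw [htop]
  exact Subgroup.mem_top τ

theorem isFieldIndex_over_intermediateField_bot (hp : p.Prime) (hσ : ∀ τ, τ ∈ Subgroup.zpowers σ)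
    (hcard : Nat.card Gal(K/F) = p ^ n) {ξ : Fˣ} (hξ : IsPrimitiveRoot ξ p) {j : ℕ} (hj : j < n)
    {E : IntermediateField F K} (hE : Module.finrank F E = p ^ j)
    (hr : IsRootNorm p n σ (Units.map (algebraMap F K : F →* K) ξ) j) : IsFieldIndex p E K ⊥ := by
  obtain ⟨ρ, hρ, hcardE, hρσ⟩ :=
    exists_generator_over_intermediateField hp hσ hcard hj.le hE
  refine isFieldIndex_bot (ξ := Units.map (algebraMap F E : F →* E) ξ) hp hρ hcardE (by omega)
    (hξ.map_of_injective (Units.map_injective (algebraMap F E).injective)) ?_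
  exact (isRootNorm_subextension_iff hρσ _ 0).mpr hr

theorem isFieldIndex_over_intermediateField_coe (hp : p.Prime) (hσ : ∀ τ, τ ∈ Subgroup.zpowers σ)
    (hcard : Nat.card Gal(K/F) = p ^ n) {ξ : Fˣ} (hξ : IsPrimitiveRoot ξ p)
    (hn : p = 2 → n ≠ 1) {i j : ℕ} (hj : j ≤ i) (hi : i < n)
    {E : IntermediateField F K} (hE : Module.finrank F E = p ^ j)
    (hr : IsRootNorm p n σ (Units.map (algebraMap F K : F →* K) ξ) (i + 1))
    (hmin : ∀ t ≤ i, ¬ IsRootNorm p n σ (Units.map (algebraMap F K : F →* K) ξ) t) :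
    IsFieldIndex p E K ((i - j : ℕ) : WithBot ℕ) := by
  obtain ⟨ρ, hρ, hcardE, hρσ⟩ :=
    exists_generator_over_intermediateField hp hσ hcard (hj.trans hi.le) hE
  have hK := isCyclicKummer_of_orderOf_eq hp (orderOf_generator hσ hcard) hξ
  refine isFieldIndex_coe (ξ := Units.map (algebraMap F E : F →* E) ξ) hp hρ hcardE
    (hξ.map_of_injective (Units.map_injective (algebraMap F E).injective)) ?_ (by omega) ?_ ?_
  -- If u² = -1, then σu/u = ±1. Since j = n - 1 ≥ 1, its p^j-th power is 1, so σ^{p^j} fixes u.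
  · intro h2 hnj u hu
    have hu' : u ^ p = Units.map (algebraMap F K : F →* K) ξ := h2 ▸ hu
    have hfix := hK.smul_root (σ • u / u) (by
      rw [div_pow, ← smul_pow', hu', hK.smul_root _ hK.root_pow, div_self'])
    have hpow : (σ • u / u) ^ p ^ j = 1 := by
      have hj0 : j = (j - 1) + 1 := by have := hn h2; omega
      rw [hj0, pow_succ', pow_mul, div_pow, ← smul_pow', hu', hK.smul_root _ hK.root_pow, div_self',
        one_pow]
    rw [hρσ, ← div_eq_one, ← partialNorm.apply_smul_div, partialNorm.of_fixed hfix, hpow]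
  · refine (isRootNorm_subextension_iff hρσ _ _).mpr ?_
    rwa [show j + (i - j + 1) = i + 1 by omega]
  · intro t ht h
    exact hmin (j + t) (by omega) ((isRootNorm_subextension_iff hρσ _ _).mp h)

theorem isFieldIndex_intermediateField (hp : p.Prime) (hσ : ∀ τ, τ ∈ Subgroup.zpowers σ)
    (hcard : Nat.card Gal(K/F) = p ^ n) {ξ : Fˣ} (hξ : IsPrimitiveRoot ξ p) {j : ℕ} (hj0 : 0 < j)
    (hj : j < n) {E : IntermediateField F K} (hE : Module.finrank F E = p ^ j) :
    IsFieldIndex p F E ⊥ := by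
  have hK := isCyclicKummer_of_orderOf_eq hp (orderOf_generator hσ hcard) hξ
  have : IsCyclic Gal(K/F) := ⟨σ, hσ⟩
  have : IsAbelianGalois F K := IsAbelianGalois.of_isCyclic F K
  set ρ := AlgEquiv.restrictNormalHom E σ with hρdef
  have hρ : ∀ τ, τ ∈ Subgroup.zpowers ρ := by
    intro τ
    obtain ⟨τ', rfl⟩ := AlgEquiv.restrictNormalHom_surjective (F := F) (K₁ := E) K τ
    obtain ⟨t, rfl⟩ := hσ τ'
    exact ⟨t, (map_zpow _ _ _).symm⟩
  have hcardE : Nat.card Gal(E/F) = p ^ j := by rw [IsGalois.card_aut_eq_finrank, hE]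
  refine isFieldIndex_bot hp hρ hcardE hj0 hξ ?_
  obtain ⟨b, hb, hbξ⟩ := hK.exists_fixed_norm_eq_root hj
  have hbE : (b : K) ∈ E := (mem_intermediateField_iff hp hσ hcard hj.le hE).mpr
    (by simpa [AlgEquiv.smul_units_def] using congrArg Units.val hb)
  refine ⟨Units.mk0 ⟨b, hbE⟩ fun h => b.ne_zero (congrArg Subtype.val h), ?_⟩
  rw [pow_zero, pow_one, Nat.sub_zero]
  refine Units.ext (Subtype.ext ?_)
  rw [val_partialNorm]
  have h1 := congrArg Units.val hbξ
  rw [val_partialNorm] at h1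
  refine Eq.trans ?_ h1
  push_cast
  refine Finset.prod_congr rfl fun t _ => ?_
  rw [hρdef, ← map_pow]
  exact AlgEquiv.restrictNormal_commutes (σ ^ t) E ⟨b, hbE⟩

end

theorem corollary3 (p : ℕ) (hp : p.Prime) (n : ℕ) (hn : 1 ≤ n)
    (F : Type*) (K : Type*) [Field F] [Field K] [Algebra F K]
    [FiniteDimensional F K] [IsGalois F K]
    (hcyc : IsCyclic Gal(K/F)) (hcard : Nat.card Gal(K/F) = p ^ n)
    (hroot : ∃ ξ : F, IsPrimitiveRoot ξ p)
    (htwo : p = 2 → 1 < n ∨ ∃ y : K, Algebra.norm F y = -1) :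
    ∃ m : WithBot ℕ, IsFieldIndex p F K m ∧
      (∀ j : ℕ, j ≤ n - 1 → ∀ Kj : IntermediateField F K, Module.finrank F Kj = p ^ j →
        (∀ i : ℕ, m = (i : WithBot ℕ) → j ≤ i →
          IsFieldIndex p Kj K ((i - j : ℕ) : WithBot ℕ)) ∧
        (∀ i : ℕ, m = (i : WithBot ℕ) → i < j → IsFieldIndex p Kj K ⊥) ∧
        (m = ⊥ → IsFieldIndex p Kj K ⊥)) ∧
      (∀ j : ℕ, 0 < j → j ≤ n - 1 → ∀ Kj : IntermediateField F K,
        Module.finrank F Kj = p ^ j → IsFieldIndex p F Kj ⊥) := by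
  obtain ⟨σ, hσ⟩ := hcyc
  obtain ⟨ξ₀, hξ₀⟩ := hroot
  obtain ⟨ξ, rfl⟩ : ∃ ξ : Fˣ, (ξ : F) = ξ₀ := ⟨Units.mk0 ξ₀ (hξ₀.ne_zero hp.ne_zero), rfl⟩
  have hξ : IsPrimitiveRoot ξ p := IsPrimitiveRoot.coe_units_iff.mp hξ₀
  have hK := isCyclicKummer_of_orderOf_eq hp (orderOf_generator hσ hcard) hξ
  set ξK := Units.map (algebraMap F K : F →* K) ξ with hξK
  have hsub : ∀ j : ℕ, 0 < j → j ≤ n - 1 → ∀ Kj : IntermediateField F K,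
      Module.finrank F Kj = p ^ j → IsFieldIndex p F Kj ⊥ := fun j hj0 hj Kj hKj =>
    isFieldIndex_intermediateField hp hσ hcard hξ hj0 (by omega) hKj
  by_cases h0 : IsRootNorm p n σ ξK 0
  · refine ⟨⊥, isFieldIndex_bot hp hσ hcard hn hξ h0, fun j hj Kj hKj => ⟨?_, ?_, fun _ => ?_⟩, hsub⟩
    · exact fun i hi => absurd hi WithBot.bot_ne_coe
    · exact fun i hi => absurd hi WithBot.bot_ne_coe
    · exact isFieldIndex_over_intermediateField_bot hp hσ hcard hξ (by omega) hKj
        (hK.isRootNorm_mono j.zero_le (by omega) h0)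
  -- In degree 2 the hypothesis makes ξ = -1 a norm from K, the case already settled.
  have hn2 : p = 2 → n ≠ 1 := by
    rintro h2 rfl
    obtain ⟨y, hy⟩ := (htwo h2).resolve_left (lt_irrefl 1)
    have hy0 : y ≠ 0 := by
      rintro rfl
      simp at hy
    have hξ1 : (ξ : F) = -1 := IsPrimitiveRoot.eq_neg_one_of_two_right (h2 ▸ hξ₀)
    refine h0 ⟨Units.mk0 y hy0, ?_⟩
    rw [pow_zero, pow_one, Nat.sub_zero, ← map_norm_eq_partialNorm hσ hcard, hξK]
    congr 1
    ext
    simp [hy, hξ1]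
  classical
  have hex : ∃ s, IsRootNorm p n σ ξK s := ⟨n, IsCyclicKummer.isRootNorm_self p n σ ξK⟩
  obtain ⟨i, hi⟩ := Nat.exists_eq_succ_of_ne_zero (n := Nat.find hex) fun h =>
    h0 (h ▸ Nat.find_spec hex)
  have hr : IsRootNorm p n σ ξK (i + 1) := by
    have := Nat.find_spec hex
    rwa [hi] at this
  have hin : i < n := by
    have := Nat.find_min' hex (IsCyclicKummer.isRootNorm_self p n σ ξK)
    omega
  have hmin : ∀ j ≤ i, ¬ IsRootNorm p n σ ξK j := fun j hj => Nat.find_min hex (by omega)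
  refine ⟨i, isFieldIndex_coe hp hσ hcard hξ (fun h2 h1 => absurd h1 (hn2 h2)) hin hr hmin,
    fun j hj Kj hKj => ⟨fun i' hi' hji => ?_, fun i' hi' hji => ?_, fun h => ?_⟩, hsub⟩
  · obtain rfl := WithBot.coe_injective hi'
    exact isFieldIndex_over_intermediateField_coe hp hσ hcard hξ hn2 hji hin hKj hr hmin
  · obtain rfl := WithBot.coe_injective hi'
    exact isFieldIndex_over_intermediateField_bot hp hσ hcard hξ (by omega) hKj
      (hK.isRootNorm_mono hji (by omega) hr)
  · exact absurd h WithBot.coe_ne_bot
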